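/- For positive integers $\ell$ and integers $m\ge 0$ let $p_{1,\ell}(m)$ be the number of 2-color partitions of $m$ in which one of the colors appears only in parts that are multiples of $\ell$, so that $$\sum_{m\ge 0}p_{1,\ell}(m)q^m=\prod_{j\ge 1}\frac{1}{(1-q^{j})(1-q^{\ell j})}.$$ For all integers $n,\beta\ge 0$ and $k\ge 1$, all the fractions below are integers, and \begin{align*} p_{1,5^{2k-1}}\left(5^{2k+\beta-1}n+\frac{18\cdot5^{2k+\beta-1}+5^{2k-1}+1}{24}\right)&\equiv 0\pmod{5^{2k+\beta-1}},\\ p_{1,5^{2k}}\left(5^{2k+2\beta-1}n+\frac{14\cdot5^{2k+2\beta-1}+5^{2k}+1}{24}\right)&\equiv 0\pmod{5^{2k+\beta-1}},\\ p_{1,5^{2k}}\left(5^{2k+2\beta}n+\frac{22\cdot5^{2k+2\beta}+5^{2k}+1}{24}\right)&\equiv 0\pmod{5^{2k+\beta}},\\ p_{1,5^{2k-1}}\left(5^{2k+\beta}n+\frac{(24r+18)\cdot5^{2k+\beta-1}+5^{2k-1}+1}{24}\right)&\equiv 0\pmod{5^{2k+\beta}}\quad\text{for each } r\in\{2,3,4\},\\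 p_{1,5^{2k}}\left(5^{2k+2\beta+2}n+\frac{22\cdot5^{2k+2\beta+2}+5^{2k}+1}{24}\right)&\equiv 0\pmod{5^{2k+\beta+1}}. \end{align*} -/

import Mathlib

/-- A 2-color partition of `n` in which one of the two colors appears only in parts that are
multiples of `ℓ`: a splitting `n = a + b`, a partition of `a` (the parts in the unrestricted color),
and a partition of `b` all of whose parts are multiples of `ℓ` (the parts in the other color). -/
abbrev TwoColorPartition (ℓ n : ℕ) : Type :=
  (ab : {ab : ℕ × ℕ // ab ∈ Finset.HasAntidiagonal.antidiagonal n}) ×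
    (Nat.Partition ab.1.1 × {μ : Nat.Partition ab.1.2 // ∀ i ∈ μ.parts, ℓ ∣ i})

/-- `p_{1,ℓ}(n)`: the number of 2-color partitions of `n` in which one of the colors appears only
in parts that are multiples of `ℓ`. -/
def twoColorCount (ℓ n : ℕ) : ℕ := Fintype.card (TwoColorPartition ℓ n)

/-!
Write `E = ∏ (1 - X ^ n)`, `P = 1 / E`, and let `U` be Atkin's operator, which keeps the
coefficients at multiples of `5`. The generating series for `ℓ = 5 ^ m` is `P(X) P(X ^ ℓ)`. A
progression of step `5 ^ j` is extracted by applying `f ↦ U (X ^ e f)` for `j` values of `e`. As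
`U (f(X ^ 5) g) = f U g`, the factors in `X ^ 5` pass through `U`, and what remains at each stage is
`U`, `U (s ·)` or `U (s ^ 2 ·)` with `s = X E(X ^ 25) / E(X)`, acting on polynomials in the
Hauptmodul `T = X E(X ^ 5) ^ 6 / E(X) ^ 6`.

As `T(X) T(X ^ 5) = s ^ 6`, these operators are determined by the series `U (s ^ i)`. They satisfy
a linear recursion because `s` is the root of a quintic over the series in `X ^ 5`
(`etaQuot_pow_five`), and the recursion gives Watson's bounds for the valuations of the coefficients
(`atkinU_etaQuot_pow_mem`). Hence `U` and `U (s ·)` raise the exponent `N` of `watsonModule N` by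
one, and `U (s ^ 2 ·)` does not lower it. The classical argument for Ramanujan's congruences, with
`U (s ·)` and `U` in turn, gives `5 ^ (2 k - 1)` after `2 k - 1` steps. From there on, the second
factor `P(X ^ ℓ)` has been reduced to a series in `X` or `X ^ 5`, and the steps continue with
`U (s ·)` alone for odd `m`, and with `U` and `U (s ^ 2 ·)` in turn for even `m`. For the classes
`r = 2, 3, 4` one more factor `5` comes from the term in `T`, which modulo `5` contributes `X E ^ 3`
times a series in `X ^ 5`, and `E ^ 3` vanishes modulo `5` in these classes.

The quintic rests on the dissection `E = A - W + B` by exponents modulo `5`, where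
`W = X E(X ^ 25)` by the pentagonal number theorem, and on two facts. The first is `A B = -W ^ 2`
(`partA_mul_partB`): the terms of `E ^ 2` belong to pairs of integers `u, v` congruent to `-1`
modulo `6`, and multiplying the conjugate of `u + i v` by `-(2 + i) / (2 - i)` shows that the terms
with `2 + i ∣ u + i v` add up to zero, and so do those with `2 - i ∣ u + i v`. Together these are
all terms with exponents congruent to `2` modulo `5`, those of `W ^ 2` being counted twice, so that
`W ^ 2 + 2 A B = -W ^ 2`. The second is that the product of the
conjugates `E(ω X)` over the fifth roots of unity is `E(X ^ 5) ^ 6 / E(X ^ 25)`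
(`dilate_euler_pow_six`).
-/

open PowerSeries

namespace FiveAdicPartition

/-! ### Residue classes of exponents modulo five -/

/-- The power series all of whose exponents lie in the residue class `r` modulo `5`. -/
def residueClass (r : ZMod 5) : Submodule ℤ ℤ⟦X⟧ where
  carrier := {f | ∀ n : ℕ, (n : ZMod 5) ≠ r → coeff n f = 0}
  add_mem' hf hg n hn := by rw [map_add, hf n hn, hg n hn, add_zero]
  zero_mem' n _ := map_zero _
  smul_mem' c f hf n hn := by rw [map_smul, hf n hn, smul_zero]

instance : SetLike.GradedMonoid residueClass where
  one_mem n hn := by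
    rw [coeff_one, if_neg]
    rintro rfl
    exact hn (by simp)
  mul_mem {r r' f g} hf hg n hn := by
    rw [coeff_mul]
    refine Finset.sum_eq_zero fun ij hij => ?_
    rw [Finset.HasAntidiagonal.mem_antidiagonal] at hij
    by_cases hi : (ij.1 : ZMod 5) = r
    · rw [hg ij.2, mul_zero]
      intro hj
      exact hn (by rw [← hij, Nat.cast_add, hi, hj])
    · rw [hf ij.1 hi, zero_mul]

theorem monomial_mem_residueClass {a w b : ℤ⟦X⟧} (ha : a ∈ residueClass 0)
    (hw : w ∈ residueClass 1) (hb : b ∈ residueClass 2) (i j k : ℕ) :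
    a ^ i * w ^ j * b ^ k ∈ residueClass (j + 2 * k) := by
  have h := SetLike.mul_mem_graded
    (SetLike.mul_mem_graded (SetLike.pow_mem_graded i ha) (SetLike.pow_mem_graded j hw))
    (SetLike.pow_mem_graded k hb)
  convert h using 1
  simp [mul_comm]

/-- The substitution `X ↦ X ^ 5`. -/
noncomputable def dilate : ℤ⟦X⟧ →ₐ[ℤ] ℤ⟦X⟧ := PowerSeries.expand 5 (by norm_num)

theorem coeff_dilate_mul (f : ℤ⟦X⟧) (n : ℕ) : coeff (5 * n) (dilate f) = coeff n f :=
  PowerSeries.coeff_expand_mul _ _ _ _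

theorem coeff_dilate_of_not_dvd (f : ℤ⟦X⟧) {n : ℕ} (h : ¬ 5 ∣ n) : coeff n (dilate f) = 0 :=
  PowerSeries.coeff_expand_of_not_dvd _ _ _ h

@[simp]
theorem dilate_X : dilate X = X ^ 5 := PowerSeries.expand_X _ _

theorem dilate_mem_residueClass (f : ℤ⟦X⟧) : dilate f ∈ residueClass 0 := fun n hn =>
  coeff_dilate_of_not_dvd f fun h => hn ((ZMod.natCast_eq_zero_iff n 5).2 h)

/-- Atkin's operator `U₅`, which keeps the coefficients at multiples of `5`. -/
noncomputable def atkinU : ℤ⟦X⟧ →ₗ[ℤ] ℤ⟦X⟧ where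
  toFun f := PowerSeries.mk fun n => coeff (5 * n) f
  map_add' f g := by ext n; simp
  map_smul' c f := by ext n; simp [-zsmul_eq_mul, coeff_mk]

theorem coeff_atkinU (f : ℤ⟦X⟧) (n : ℕ) : coeff n (atkinU f) = coeff (5 * n) f :=
  PowerSeries.coeff_mk n fun n => coeff (5 * n) f

theorem atkinU_eq_zero {r : ZMod 5} (hr : r ≠ 0) {f : ℤ⟦X⟧} (hf : f ∈ residueClass r) :
    atkinU f = 0 := by
  ext n
  rw [coeff_atkinU, map_zero, hf]
  rw [Nat.cast_mul, show ((5 : ℕ) : ZMod 5) = 0 from rfl, zero_mul]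
  exact hr.symm

theorem atkinU_dilate_mul (f g : ℤ⟦X⟧) : atkinU (dilate f * g) = f * atkinU g := by
  ext n
  rw [coeff_atkinU, coeff_mul, coeff_mul]
  symm
  refine Finset.sum_of_injOn (fun ij => (5 * ij.1, 5 * ij.2)) ?_ ?_ ?_ ?_
  · rintro ⟨i, j⟩ _ ⟨i', j'⟩ _ h
    simp only [Prod.mk.injEq] at h ⊢
    omega
  · rintro ⟨i, j⟩ h
    simp only [SetLike.mem_coe,
      Finset.HasAntidiagonal.mem_antidiagonal] at h ⊢
    omega
  · rintro ⟨i, j⟩ h h'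
    rw [coeff_dilate_of_not_dvd, zero_mul]
    rintro ⟨i', rfl⟩
    rw [Finset.HasAntidiagonal.mem_antidiagonal] at h
    refine h' ⟨(i', n - i'), ?_, ?_⟩
    · simp only [SetLike.mem_coe,
        Finset.HasAntidiagonal.mem_antidiagonal] at h ⊢
      omega
    · simp only [Prod.mk.injEq, true_and] at h ⊢
      omega
  · rintro ⟨i, j⟩ _
    rw [coeff_dilate_mul, coeff_atkinU]

theorem atkinU_dilate (f : ℤ⟦X⟧) : atkinU (dilate f) = f := by
  ext n
  rw [coeff_atkinU, coeff_dilate_mul]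

theorem atkinU_intCast_mul (c : ℤ) (f : ℤ⟦X⟧) : atkinU ((c : ℤ⟦X⟧) * f) = c * atkinU f := by
  rw [← zsmul_eq_mul, map_zsmul, zsmul_eq_mul]

/-! ### The five-dissection of Euler's product -/

theorem abs_le_pentagonal (x : ℤ) : |x| ≤ pentagonal x := by
  have h := two_mul_natCast_pentagonal x
  rcases le_or_gt x 0 with hx | hx
  · rw [abs_of_nonpos hx]
    nlinarith
  · rw [abs_of_pos hx]
    nlinarith

theorem mem_Icc_of_pentagonal_le {x : ℤ} {N : ℕ} (h : pentagonal x ≤ N) :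
    x ∈ Finset.Icc (-(N : ℤ)) N := by
  have h1 := abs_le.1 ((abs_le_pentagonal x).trans (Nat.cast_le.2 h))
  exact Finset.mem_Icc.2 h1

/-- The part `∑ (-1) ^ x X ^ (x (3 x - 1) / 2)` of Euler's pentagonal series in which `x` runs over
the integers that satisfy `p`. -/
noncomputable def pentagonalPart (p : ℤ → Prop) [DecidablePred p] : ℤ⟦X⟧ :=
  PowerSeries.mk fun n => ∑ x ∈ Finset.Icc (-(n : ℤ)) n,
    if pentagonal x = n ∧ p x then (x.negOnePow : ℤ) else 0

theorem coeff_pentagonalPart (p : ℤ → Prop) [DecidablePred p] {n N : ℕ} (h : n ≤ N) :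
    coeff n (pentagonalPart p) = ∑ x ∈ Finset.Icc (-(N : ℤ)) N,
      if pentagonal x = n ∧ p x then (x.negOnePow : ℤ) else 0 := by
  rw [pentagonalPart, coeff_mk]
  refine Finset.sum_subset (Finset.Icc_subset_Icc (by omega) (by omega)) fun x _ hx => ?_
  rw [if_neg]
  rintro ⟨h, -⟩
  exact hx (mem_Icc_of_pentagonal_le h.le)

theorem coeff_pentagonalPart_pentagonal (p : ℤ → Prop) [DecidablePred p] (x : ℤ) :
    coeff (pentagonal x) (pentagonalPart p) = if p x then (x.negOnePow : ℤ) else 0 := by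
  rw [coeff_pentagonalPart p le_rfl, Finset.sum_eq_single x]
  · simp only [true_and]
  · intro y _ hy
    rw [if_neg]
    rintro ⟨h, -⟩
    exact hy (pentagonal_injective h)
  · intro h
    exact absurd (mem_Icc_of_pentagonal_le le_rfl) h

theorem coeff_pentagonalPart_eq_zero (p : ℤ → Prop) [DecidablePred p] {n : ℕ}
    (h : ∀ x, pentagonal x = n → ¬ p x) : coeff n (pentagonalPart p) = 0 := by
  rw [coeff_pentagonalPart p le_rfl]
  refine Finset.sum_eq_zero fun x _ => if_neg ?_
  rintro ⟨h1, h2⟩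
  exact h x h1 h2

theorem pentagonalPart_true : pentagonalPart (fun _ => True) = pentagonalSeries ℤ := by
  ext n
  by_cases h : n ∈ Set.range pentagonal
  · obtain ⟨x, rfl⟩ := h
    rw [coeff_pentagonalPart_pentagonal, if_pos trivial]
    exact (coeff_pentagonalSeries_pentagonal ℤ x).symm
  · rw [coeff_pentagonalSeries_eq_zero _ h, coeff_pentagonalPart_eq_zero]
    intro x hx
    exact absurd ⟨x, hx⟩ h

/-- The coefficient sum over pairs `(x, y)` that satisfy `R` and represent `N` as a sum of two
generalized pentagonal numbers. -/
noncomputable def pentagonalPairSum (N : ℕ) (R : ℤ × ℤ → Prop) [DecidablePred R] : ℤ :=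
  ∑ z ∈ Finset.Icc (-(N : ℤ)) N ×ˢ Finset.Icc (-(N : ℤ)) N,
    if pentagonal z.1 + pentagonal z.2 = N ∧ R z then ((z.1 + z.2).negOnePow : ℤ) else 0

theorem coeff_pentagonalPart_mul (p q : ℤ → Prop) [DecidablePred p] [DecidablePred q] (N : ℕ) :
    coeff N (pentagonalPart p * pentagonalPart q) =
      pentagonalPairSum N (fun z => p z.1 ∧ q z.2) := by
  have h : ∀ ij ∈ Finset.HasAntidiagonal.antidiagonal N,
      coeff ij.1 (pentagonalPart p) * coeff ij.2 (pentagonalPart q) =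
      ∑ z ∈ Finset.Icc (-(N : ℤ)) N ×ˢ Finset.Icc (-(N : ℤ)) N,
        if ij = (pentagonal z.1, pentagonal z.2) then
          (if p z.1 ∧ q z.2 then ((z.1 + z.2).negOnePow : ℤ) else 0) else 0 := by
    intro ij hij
    rw [Finset.HasAntidiagonal.mem_antidiagonal] at hij
    rw [coeff_pentagonalPart p (show ij.1 ≤ N by omega),
      coeff_pentagonalPart q (show ij.2 ≤ N by omega), Finset.sum_mul_sum, Finset.sum_product]
    refine Finset.sum_congr rfl fun x _ => Finset.sum_congr rfl fun y _ => ?_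
    rw [Int.negOnePow_add]
    by_cases h1 : pentagonal x = ij.1 <;> by_cases h2 : pentagonal y = ij.2 <;>
      by_cases h3 : p x <;> by_cases h4 : q y <;>
      simp [h1, h2, h3, h4, Prod.ext_iff, eq_comm]
    · intro h; exact absurd h.symm h2
    · intro h; exact absurd h.symm h1
    · intro h; exact absurd h.symm h1
  rw [coeff_mul, Finset.sum_congr rfl h, Finset.sum_comm, pentagonalPairSum]
  refine Finset.sum_congr rfl fun z _ => ?_
  rw [Finset.sum_ite_eq']
  simp only [Finset.HasAntidiagonal.mem_antidiagonal, ite_and]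

theorem pentagonalPairSum_swap (N : ℕ) (R : ℤ × ℤ → Prop) [DecidablePred R] :
    pentagonalPairSum N (fun z => R z.swap) = pentagonalPairSum N R := by
  refine Finset.sum_equiv (Equiv.prodComm ℤ ℤ) (fun z => ?_) fun z _ => ?_
  · simp only [Finset.mem_product, Equiv.prodComm_apply, Prod.fst_swap, Prod.snd_swap, and_comm]
  · simp only [Equiv.prodComm_apply, Prod.fst_swap, Prod.snd_swap, add_comm]

/-- With `u = 6 x - 1` and `v = 6 y - 1`, the sum runs over the pairs for which `2 + i` divides
`u + i v`. The map `z ↦ -(2 + i) / (2 - i) * conj z` is an involution of these Gaussian integers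
which keeps both coordinates in the class of `-1` modulo `6`, preserves the norm and reverses the
sign of the summand. -/
theorem pentagonalPairSum_eq_zero (N : ℕ) :
    pentagonalPairSum N (fun z => (5 : ℤ) ∣ 3 * z.1 - 2 - z.2) = 0 := by
  have key : ∀ x y x' y' : ℤ, 5 * x' = 2 - 3 * x - 4 * y → 5 * y' = 3 * y - 4 * x + 1 →
      pentagonal x + pentagonal y = N → pentagonal x' + pentagonal y' = N := by
    intro x y x' y' hx hy h
    have h1 := two_mul_natCast_pentagonal x
    have h2 := two_mul_natCast_pentagonal y
    have h3 := two_mul_natCast_pentagonal x'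
    have h4 := two_mul_natCast_pentagonal y'
    have h5 : 25 * (x' * (3 * x' - 1) + y' * (3 * y' - 1)) =
        25 * (x * (3 * x - 1) + y * (3 * y - 1)) := by
      linear_combination (15 * x' + 3 * (2 - 3 * x - 4 * y) - 5) * hx +
        (15 * y' + 3 * (3 * y - 4 * x + 1) - 5) * hy
    omega
  have mem : ∀ x y : ℤ, pentagonal x + pentagonal y = N →
      (x, y) ∈ Finset.Icc (-(N : ℤ)) N ×ˢ Finset.Icc (-(N : ℤ)) N := fun x y h =>
    Finset.mem_product.2 ⟨mem_Icc_of_pentagonal_le (show pentagonal x ≤ N by omega),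
      mem_Icc_of_pentagonal_le (show pentagonal y ≤ N by omega)⟩
  have sign : ∀ x y x' y' : ℤ, 5 * x' = 2 - 3 * x - 4 * y → 5 * y' = 3 * y - 4 * x + 1 →
      ((x + y).negOnePow : ℤ) + ((x' + y').negOnePow : ℤ) = 0 := by
    intro x y x' y' hx hy
    have h : Odd ((x' + y') - (x + y)) := by
      rw [Int.odd_iff]
      omega
    rw [show x' + y' = (x' + y' - (x + y)) + (x + y) by ring,
      Int.negOnePow_add (x' + y' - (x + y)), Int.negOnePow_odd _ h]
    simp
  rw [pentagonalPairSum, ← Finset.sum_filter]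
  refine Finset.sum_involution
    (fun z _ => ((2 - 3 * z.1 - 4 * z.2) / 5, (3 * z.2 - 4 * z.1 + 1) / 5)) ?_ ?_ ?_ ?_
  · rintro ⟨x, y⟩ h
    simp only [Finset.mem_filter] at h ⊢
    exact sign x y _ _ (by omega) (by omega)
  · rintro ⟨x, y⟩ h _ heq
    simp only [Finset.mem_filter, Prod.mk.injEq] at h heq
    omega
  · rintro ⟨x, y⟩ h
    simp only [Finset.mem_filter] at h ⊢
    have h' := key x y ((2 - 3 * x - 4 * y) / 5) ((3 * y - 4 * x + 1) / 5)
      (by omega) (by omega) h.2.1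
    exact ⟨mem _ _ h', h', by omega⟩
  · rintro ⟨x, y⟩ h
    simp only [Finset.mem_filter, Prod.mk.injEq] at h ⊢
    omega

/-- The residue of `x (3 x - 1) / 2` modulo `5` depends on that of `x`. -/
theorem pentagonal_emod_five (x : ℤ) :
    (x % 5 = 0 ∧ pentagonal x % 5 = 0) ∨ (x % 5 = 1 ∧ pentagonal x % 5 = 1) ∨
    (x % 5 = 2 ∧ pentagonal x % 5 = 0) ∨ (x % 5 = 3 ∧ pentagonal x % 5 = 2) ∨
    (x % 5 = 4 ∧ pentagonal x % 5 = 2) := by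
  have h := two_mul_natCast_pentagonal x
  obtain ⟨q, r, hq, h0, h5⟩ : ∃ q r : ℤ, x = 5 * q + r ∧ 0 ≤ r ∧ r < 5 :=
    ⟨x / 5, x % 5, by omega, by omega, by omega⟩
  have h' : 2 * (pentagonal x : ℤ) = 5 * (15 * q ^ 2 + 6 * q * r - q) + r * (3 * r - 1) := by
    rw [h, hq]
    ring
  generalize 15 * q ^ 2 + 6 * q * r - q = m at h'
  interval_cases r <;> omega

/-- In a sum of two generalized pentagonal numbers congruent to `2` modulo `5`, the indices satisfy
one of two linear congruences, and both only if the two numbers are `1` modulo `5`. -/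
theorem pentagonalPairSum_of_emod_five (N : ℕ) (hN : N % 5 = 2) :
    pentagonalPairSum N (fun _ => True ∧ True) =
      -pentagonalPairSum N (fun z => z.1 % 5 = 1 ∧ z.2 % 5 = 1) := by
  have hA := pentagonalPairSum_eq_zero N
  have hB := (pentagonalPairSum_swap N (fun z => (5 : ℤ) ∣ 3 * z.1 - 2 - z.2)).trans hA
  rw [eq_neg_iff_add_eq_zero, ← add_zero 0]
  nth_rewrite 1 [← hA]
  rw [← hB]
  simp only [pentagonalPairSum, ← Finset.sum_add_distrib]
  refine Finset.sum_congr rfl fun z _ => ?_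
  by_cases h : pentagonal z.1 + pentagonal z.2 = N
  · have h1 := pentagonal_emod_five z.1
    have h2 := pentagonal_emod_five z.2
    simp only [h, true_and, Prod.fst_swap, Prod.snd_swap, and_self, if_true]
    by_cases h3 : z.1 % 5 = 1 ∧ z.2 % 5 = 1
    · rw [if_pos h3, if_pos (by omega), if_pos (by omega)]
    · rw [if_neg h3]
      by_cases h4 : (5 : ℤ) ∣ 3 * z.1 - 2 - z.2
      · rw [if_pos h4, if_neg (by omega)]
      · rw [if_neg h4, if_pos (by omega), add_comm]
  · simp [h]

/-- Euler's product `∏ (1 - X ^ n)`, as a pentagonal series. -/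
noncomputable abbrev euler : ℤ⟦X⟧ := pentagonalSeries ℤ

/-- The part of Euler's product with exponents divisible by `5`. -/
noncomputable def partA : ℤ⟦X⟧ := pentagonalPart fun x => x % 5 = 0 ∨ x % 5 = 2

/-- The part of Euler's product with exponents congruent to `2` modulo `5`. -/
noncomputable def partB : ℤ⟦X⟧ := pentagonalPart fun x => x % 5 = 3 ∨ x % 5 = 4

/-- The negative of the part of Euler's product with exponents congruent to `1` modulo `5`; it is
`X ∏ (1 - X ^ (25 n))`. -/
noncomputable def partW : ℤ⟦X⟧ := X * dilate (dilate euler)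

theorem pentagonal_five_mul_add_one (y : ℤ) :
    pentagonal (5 * y + 1) = 5 * (5 * pentagonal (-y)) + 1 := by
  have h1 := two_mul_natCast_pentagonal (5 * y + 1)
  have h2 := two_mul_natCast_pentagonal_neg y
  have h3 : (5 * y + 1) * (3 * (5 * y + 1) - 1) = 25 * (y * (3 * y + 1)) + 2 := by ring
  omega

theorem partW_eq : partW = -pentagonalPart fun x => x % 5 = 1 := by
  ext n
  rw [map_neg]
  by_cases h : ∃ y : ℤ, pentagonal (5 * y + 1) = n
  · obtain ⟨y, rfl⟩ := h
    rw [coeff_pentagonalPart_pentagonal, if_pos (by omega), pentagonal_five_mul_add_one, partW,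
      coeff_succ_X_mul, coeff_dilate_mul, coeff_dilate_mul, coeff_pentagonalSeries_pentagonal,
      show 5 * y + 1 = 2 * (3 * y) + 1 + -y by ring, Int.negOnePow_add,
      Int.negOnePow_odd _ (odd_two_mul_add_one (3 * y)), neg_one_mul, Units.val_neg, neg_neg]
    rfl
  · have h0 : coeff n (pentagonalPart fun x => x % 5 = 1) = 0 := by
      refine coeff_pentagonalPart_eq_zero _ fun x hx hx1 => h ⟨x / 5, ?_⟩
      rw [← hx]
      congr 1
      omega
    rw [h0, neg_zero, partW]
    rcases n with _ | n
    · simp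
    rw [coeff_succ_X_mul]
    by_cases h5 : 5 ∣ n
    · obtain ⟨m, rfl⟩ := h5
      rw [coeff_dilate_mul]
      by_cases h25 : 5 ∣ m
      · obtain ⟨l, rfl⟩ := h25
        rw [coeff_dilate_mul]
        apply coeff_pentagonalSeries_eq_zero
        rintro ⟨y, rfl⟩
        exact h ⟨-y, by rw [pentagonal_five_mul_add_one, neg_neg]⟩
      · exact coeff_dilate_of_not_dvd _ h25
    · exact coeff_dilate_of_not_dvd _ h5

theorem pentagonalPart_mem_residueClass (p : ℤ → Prop) [DecidablePred p] (r : ℕ)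
    (h : ∀ x, p x → pentagonal x % 5 = r % 5) : pentagonalPart p ∈ residueClass r := by
  intro n hn
  refine coeff_pentagonalPart_eq_zero p fun x hx hp => hn ?_
  rw [← hx]
  exact (ZMod.natCast_eq_natCast_iff _ _ 5).2 (h x hp)

theorem partA_mem : partA ∈ residueClass 0 := by
  refine pentagonalPart_mem_residueClass _ 0 fun x hx => ?_
  have := pentagonal_emod_five x
  omega

theorem partB_mem : partB ∈ residueClass 2 := by
  refine pentagonalPart_mem_residueClass _ 2 fun x hx => ?_
  have := pentagonal_emod_five x
  omega

theorem partW_mem : partW ∈ residueClass 1 := by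
  rw [partW_eq]
  refine neg_mem (pentagonalPart_mem_residueClass _ 1 fun x hx => ?_)
  have := pentagonal_emod_five x
  omega

theorem euler_eq : euler = partA - partW + partB := by
  rw [partW_eq, sub_neg_eq_add, euler, ← pentagonalPart_true]
  ext n
  simp only [map_add, partA, partB, coeff_pentagonalPart _ (le_refl n), ← Finset.sum_add_distrib]
  refine Finset.sum_congr rfl fun x _ => ?_
  by_cases hx : pentagonal x = n
  · simp only [hx, true_and, if_true]
    rcases (by omega : x % 5 = 0 ∨ x % 5 = 1 ∨ x % 5 = 2 ∨ x % 5 = 3 ∨ x % 5 = 4)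
      with h | h | h | h | h <;> simp [h]
  · simp [hx]

/-- The outer parts of the dissection are `W / R` and `-W R` for the same `R`, which is the
Rogers-Ramanujan continued fraction in the variable `X ^ 5`. -/
theorem partA_mul_partB : partA * partB = -partW ^ 2 := by
  have hAB : partA * partB ∈ residueClass 2 := by
    simpa using SetLike.mul_mem_graded partA_mem partB_mem
  have hWW : partW * partW ∈ residueClass 2 := SetLike.mul_mem_graded partW_mem partW_mem
  have hAA : partA * partA ∈ residueClass 0 := by
    simpa using SetLike.mul_mem_graded partA_mem partA_mem
  have hAW : partA * partW ∈ residueClass 1 := by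
    simpa using SetLike.mul_mem_graded partA_mem partW_mem
  have hWB : partW * partB ∈ residueClass 3 := SetLike.mul_mem_graded partW_mem partB_mem
  have hBB : partB * partB ∈ residueClass 4 := SetLike.mul_mem_graded partB_mem partB_mem
  rw [← add_eq_zero_iff_eq_neg]
  ext n
  rw [map_zero]
  by_cases hn : n % 5 = 2
  · have hn' : (n : ZMod 5) = 2 := (ZMod.natCast_eq_natCast_iff _ 2 5).2 hn
    have h1 := pentagonalPairSum_of_emod_five n hn
    rw [← coeff_pentagonalPart_mul (fun _ => True) (fun _ => True),
      ← coeff_pentagonalPart_mul (fun x => x % 5 = 1) (fun x => x % 5 = 1), pentagonalPart_true,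
      ← neg_mul_neg (pentagonalPart fun x => x % 5 = 1), ← partW_eq,
      show pentagonalSeries ℤ * pentagonalSeries ℤ =
        partA * partA - (partA * partW + partA * partW) + (partA * partB + partA * partB +
          partW * partW) - (partW * partB + partW * partB) + partB * partB by
        rw [show pentagonalSeries ℤ = partA - partW + partB from euler_eq]; ring] at h1
    simp only [map_add, map_sub] at h1
    rw [hAA n (by rw [hn']; decide), hAW n (by rw [hn']; decide), hWB n (by rw [hn']; decide),
      hBB n (by rw [hn']; decide)] at h1
    rw [map_add, pow_two]
    linarith
  · have hn' : (n : ZMod 5) ≠ 2 := fun h => hn ((ZMod.natCast_eq_natCast_iff _ 2 5).1 h)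
    rw [map_add, pow_two, hAB n hn', hWW n hn', add_zero]

/-! ### The norm of Euler's product from `X` to `X ^ 5` -/

section Products

open scoped PowerSeries.WithPiTopology

variable {R : Type*} [CommRing R] [TopologicalSpace R] [IsTopologicalRing R]

theorem continuous_rescale (a : R) : Continuous (rescale a : R⟦X⟧ →+* R⟦X⟧) := by
  rw [continuous_iff_continuousAt]
  intro f
  rw [ContinuousAt, WithPiTopology.tendsto_iff_coeff_tendsto]
  intro n
  simp only [coeff_rescale]
  exact ((continuous_const_mul (a ^ n)).comp (WithPiTopology.continuous_coeff R n)).tendsto f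

omit [IsTopologicalRing R] in
theorem continuous_expand (ℓ : ℕ) (hℓ : ℓ ≠ 0) :
    Continuous (PowerSeries.expand ℓ hℓ : R⟦X⟧ →ₐ[R] R⟦X⟧) := by
  rw [continuous_iff_continuousAt]
  intro f
  rw [ContinuousAt, WithPiTopology.tendsto_iff_coeff_tendsto]
  intro n
  simp only [coeff_expand]
  split_ifs
  · exact (WithPiTopology.continuous_coeff R (n / ℓ)).tendsto f
  · exact tendsto_const_nhds

omit [IsTopologicalRing R] in
theorem hasProd_expand_pentagonalSeries (ℓ : ℕ) (hℓ : ℓ ≠ 0) :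
    HasProd (fun n => if ℓ ∣ n + 1 then 1 - (X : R⟦X⟧) ^ (n + 1) else 1)
      (PowerSeries.expand ℓ hℓ (pentagonalSeries R)) := by
  have h := (WithPiTopology.hasProd_one_sub_X_pow R).map _ (continuous_expand ℓ hℓ)
  have hinj : Function.Injective fun m : ℕ => ℓ * (m + 1) - 1 := by
    intro m m' hm
    have h1 : 0 < ℓ * (m + 1) := by positivity
    have h2 : 0 < ℓ * (m' + 1) := by positivity
    have h3 : ℓ * (m + 1) = ℓ * (m' + 1) := by
      simp only at hm
      omega
    have := Nat.eq_of_mul_eq_mul_left (Nat.pos_of_ne_zero hℓ) h3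
    omega
  rw [← hinj.hasProd_iff]
  · convert h using 1
    ext1 m
    have h1 : ℓ * (m + 1) - 1 + 1 = ℓ * (m + 1) := Nat.succ_pred_eq_of_pos
      (Nat.mul_pos (Nat.pos_of_ne_zero hℓ) m.succ_pos)
    simp [h1, pow_mul]
  · intro n hn
    rw [if_neg]
    rintro ⟨m, hm⟩
    refine hn ⟨m - 1, ?_⟩
    rcases m with _ | m
    · simp at hm
    · simp only [Nat.add_sub_cancel, ← hm]

end Products

theorem one_sub_pow_five_eq {S : Type*} [CommRing S] (z y : S)
    (hz : 1 + z + z ^ 2 + z ^ 3 + z ^ 4 = 0) :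
    (1 - y) * (1 - z * y) * (1 - z ^ 2 * y) * (1 - z ^ 3 * y) * (1 - z ^ 4 * y) = 1 - y ^ 5 := by
  have h5 : z ^ 5 = 1 := by linear_combination (z - 1) * hz
  have h6 : z ^ 6 = z := by linear_combination z * h5
  have h7 : z ^ 7 = z ^ 2 := by linear_combination z ^ 2 * h5
  have h8 : z ^ 8 = z ^ 3 := by linear_combination z ^ 3 * h5
  have h9 : z ^ 9 = z ^ 4 := by linear_combination z ^ 4 * h5
  have h10 : z ^ 10 = 1 := by linear_combination (z ^ 5 + 1) * h5
  have e1 : (1 - z * y) * (1 - z ^ 4 * y) = 1 - (z + z ^ 4) * y + y ^ 2 := by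
    linear_combination y ^ 2 * h5
  have e2 : (1 - z ^ 2 * y) * (1 - z ^ 3 * y) = 1 - (z ^ 2 + z ^ 3) * y + y ^ 2 := by
    linear_combination y ^ 2 * h5
  have e3 : (z + z ^ 4) * (z ^ 2 + z ^ 3) = -1 := by
    linear_combination h6 + h7 + hz
  have e4 : z ^ 2 + z ^ 3 = -1 - (z + z ^ 4) := by linear_combination hz
  rw [e4] at e3
  calc _ = (1 - y) * ((1 - z * y) * (1 - z ^ 4 * y)) * ((1 - z ^ 2 * y) * (1 - z ^ 3 * y)) := by
        ring
    _ = 1 - y ^ 5 := by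
      rw [e1, e2, e4]
      linear_combination (1 - y) * y ^ 2 * e3

theorem prod_conjugates_eq {S : Type*} [CommRing S] (a w b z : S)
    (hz : 1 + z + z ^ 2 + z ^ 3 + z ^ 4 = 0) (hab : a * b = -w ^ 2) :
    (a - w + b) * (a - z * w + z ^ 2 * b) * (a - z ^ 2 * w + (z ^ 2) ^ 2 * b) *
        (a - z ^ 3 * w + (z ^ 3) ^ 2 * b) * (a - z ^ 4 * w + (z ^ 4) ^ 2 * b) =
      (a - w + b) ^ 5 + 5 * (a - w + b) ^ 4 * w + 15 * (a - w + b) ^ 3 * w ^ 2 +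
        25 * (a - w + b) ^ 2 * w ^ 3 + 25 * (a - w + b) * w ^ 4 := by
  have h5 : z ^ 5 = 1 := by linear_combination (z - 1) * hz
  have h6 : z ^ 6 = z := by linear_combination z * h5
  have h7 : z ^ 7 = z ^ 2 := by linear_combination z ^ 2 * h5
  have h8 : z ^ 8 = z ^ 3 := by linear_combination z ^ 3 * h5
  -- the conjugates pair up to factors with coefficients in the quadratic field of `z + z ^ 4`
  have e1 : (a - z * w + z ^ 2 * b) * (a - z ^ 4 * w + (z ^ 4) ^ 2 * b) =
      (a + b) ^ 2 + 4 * w ^ 2 + (z + z ^ 4) * (w ^ 2 - (a + b) * w) := by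
    linear_combination (w ^ 2 + b ^ 2 * (z ^ 5 + 1) - w * b * z - w * b * z ^ 4) * h5 +
      a * b * h8 + (z ^ 2 + z ^ 3 - 2) * hab - w ^ 2 * hz
  have e2 : (a - z ^ 2 * w + (z ^ 2) ^ 2 * b) * (a - z ^ 3 * w + (z ^ 3) ^ 2 * b) =
      (a + b) ^ 2 + 4 * w ^ 2 + (z ^ 2 + z ^ 3) * (w ^ 2 - (a + b) * w) := by
    linear_combination (w ^ 2 + b ^ 2 * (z ^ 5 + 1)) * h5 - w * b * h7 - w * b * h8 +
      a * b * h6 + (z + z ^ 4 - 2) * hab - w ^ 2 * hz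
  have e3 : (z + z ^ 4) * (z ^ 2 + z ^ 3) = -1 := by linear_combination h6 + h7 + hz
  have e4 : z ^ 2 + z ^ 3 = -1 - (z + z ^ 4) := by linear_combination hz
  have e5 : (z + z ^ 4) * (-1 - (z + z ^ 4)) = -1 := by rw [← e4, e3]
  calc _ = (a - w + b) * ((a - z * w + z ^ 2 * b) * (a - z ^ 4 * w + (z ^ 4) ^ 2 * b)) *
        ((a - z ^ 2 * w + (z ^ 2) ^ 2 * b) * (a - z ^ 3 * w + (z ^ 3) ^ 2 * b)) := by ring
    _ = _ := by
      rw [e1, e2, e4]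
      linear_combination (a - w + b) * (w ^ 2 - (a + b) * w) ^ 2 * e5

/-- The product over the fifth roots of unity of the conjugates of Euler's product. -/
theorem expand_mul_prod_rescale {ω : ℂ} (hω : IsPrimitiveRoot ω 5) :
    PowerSeries.expand 5 (by norm_num) (PowerSeries.expand 5 (by norm_num) (pentagonalSeries ℂ)) *
      (pentagonalSeries ℂ * rescale ω (pentagonalSeries ℂ) * rescale (ω ^ 2) (pentagonalSeries ℂ) *
        rescale (ω ^ 3) (pentagonalSeries ℂ) * rescale (ω ^ 4) (pentagonalSeries ℂ)) =
      PowerSeries.expand 5 (by norm_num) (pentagonalSeries ℂ) ^ 6 := by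
  open scoped PowerSeries.WithPiTopology in
  have hE := WithPiTopology.hasProd_one_sub_X_pow ℂ
  have h5 := hasProd_expand_pentagonalSeries (R := ℂ) 5 (by norm_num)
  have h25 := h5.map _ (continuous_expand 5 (by norm_num))
  have hr (j : ℕ) := hE.map _ (continuous_rescale (ω ^ j))
  have hl := h25.mul ((((hE.mul (hr 1)).mul (hr 2)).mul (hr 3)).mul (hr 4))
  have hE5 := hE.map _ (continuous_expand 5 (by norm_num))
  have hrt := ((((h5.mul h5).mul h5).mul h5).mul h5).mul hE5
  refine Eq.trans ?_ ((hl.unique (hrt.congr_fun fun n => ?_)).trans (by ring))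
  · simp only [pow_one]
  simp only [Function.comp_apply, map_sub, map_one, map_pow, rescale_X, expand_X, mul_pow]
  set y : ℂ⟦X⟧ := X ^ (n + 1) with hy
  have hz (j : ℕ) : ((C (ω ^ j) : ℂ⟦X⟧)) ^ (n + 1) = C (ω ^ (n + 1)) ^ j := by
    rw [← map_pow, ← map_pow, ← pow_mul, ← pow_mul, mul_comm]
  have hy5 : ((X : ℂ⟦X⟧) ^ 5) ^ (n + 1) = y ^ 5 := by
    rw [hy, ← pow_mul, ← pow_mul, mul_comm]
  have hyE : PowerSeries.expand 5 (by norm_num) y = y ^ 5 := by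
    rw [hy, map_pow, expand_X, hy5]
  simp only [map_pow] at hz
  simp only [hz, hy5, pow_one]
  split_ifs with h
  · have h1 : ω ^ (n + 1) = 1 := (hω.pow_eq_one_iff_dvd _).2 h
    simp only [← map_pow, h1, one_pow, map_one, map_sub, hyE]
    ring
  · have h1 : IsPrimitiveRoot (ω ^ (n + 1)) 5 :=
      hω.pow_of_coprime _ (((Nat.Prime.coprime_iff_not_dvd (by norm_num)).2 h).symm)
    have h2 : 1 + C (ω ^ (n + 1)) + C (ω ^ (n + 1)) ^ 2 + C (ω ^ (n + 1)) ^ 3 +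
        C (ω ^ (n + 1)) ^ 4 = (0 : ℂ⟦X⟧) := by
      have h3 := h1.geom_sum_eq_zero (by norm_num)
      simp only [Finset.sum_range_succ, Finset.sum_range_zero, pow_zero, pow_one, zero_add] at h3
      rw [← map_one C, ← map_pow, ← map_pow, ← map_pow, ← map_add, ← map_add, ← map_add, ← map_add,
        h3, map_zero]
    have h3 := one_sub_pow_five_eq _ y h2
    simp only [map_pow, map_one] at h3 ⊢
    rw [h3]
    ring

theorem map_pentagonalSeries {R S : Type*} [CommRing R] [CommRing S] (f : R →+* S) :
    PowerSeries.map f (pentagonalSeries R) = pentagonalSeries S := by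
  ext n
  rw [coeff_map]
  by_cases h : n ∈ Set.range pentagonal
  · obtain ⟨x, rfl⟩ := h
    simp
  · rw [coeff_pentagonalSeries_eq_zero _ h, coeff_pentagonalSeries_eq_zero _ h, map_zero]

theorem rescale_map_of_mem_residueClass {η : ℂ} (hη : η ^ 5 = 1) {r : ℕ} {f : ℤ⟦X⟧}
    (hf : f ∈ residueClass r) :
    rescale η (PowerSeries.map (Int.castRingHom ℂ) f) =
      C η ^ r * PowerSeries.map (Int.castRingHom ℂ) f := by
  ext n
  rw [← map_pow, coeff_rescale, coeff_C_mul, coeff_map]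
  by_cases h : (n : ZMod 5) = r
  · rw [ZMod.natCast_eq_natCast_iff] at h
    rw [pow_eq_pow_mod n hη, pow_eq_pow_mod r hη, h]
  · rw [hf n h]
    simp

/-- The modular equation that relates Euler's product in `X`, `X ^ 5` and `X ^ 25`. -/
theorem dilate_euler_pow_six :
    dilate euler ^ 6 = dilate (dilate euler) * (euler ^ 5 + 5 * euler ^ 4 * partW +
      15 * euler ^ 3 * partW ^ 2 + 25 * euler ^ 2 * partW ^ 3 + 25 * euler * partW ^ 4) := by
  have hω := Complex.isPrimitiveRoot_exp 5 (by norm_num)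
  generalize Complex.exp (2 * Real.pi * Complex.I / (5 : ℕ)) = ω at hω
  set c := PowerSeries.map (Int.castRingHom ℂ) with hc
  have hE : pentagonalSeries ℂ = c euler := (map_pentagonalSeries _).symm
  have hd (f : ℤ⟦X⟧) : PowerSeries.expand 5 (by norm_num) (c f) = c (dilate f) :=
    (PowerSeries.map_expand _ _ _ _).symm
  have hroot := hω.geom_sum_eq_zero (by norm_num)
  simp only [Finset.sum_range_succ, Finset.sum_range_zero, pow_zero, pow_one, zero_add] at hroot
  have hz : 1 + C ω + C ω ^ 2 + C ω ^ 3 + C ω ^ 4 = (0 : ℂ⟦X⟧) := by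
    rw [← map_one C, ← map_pow, ← map_pow, ← map_pow, ← map_add, ← map_add, ← map_add, ← map_add,
      hroot, map_zero]
  have hr (j : ℕ) : rescale (ω ^ j) (c euler) =
      c partA - C ω ^ j * c partW + (C ω ^ j) ^ 2 * c partB := by
    have hη : (ω ^ j) ^ 5 = 1 := by rw [← pow_mul, mul_comm, pow_mul, hω.pow_eq_one, one_pow]
    rw [euler_eq, map_add, map_sub, map_add, map_sub,
      rescale_map_of_mem_residueClass hη (r := 0) (by simpa using partA_mem),
      rescale_map_of_mem_residueClass hη (r := 1) (by simpa using partW_mem),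
      rescale_map_of_mem_residueClass hη (r := 2) (by simpa using partB_mem), pow_zero, one_mul,
      pow_one, map_pow]
  have key := expand_mul_prod_rescale hω
  have h1 := hr 1
  rw [pow_one] at h1
  rw [hE, hd, hd, h1, hr 2, hr 3, hr 4] at key
  have hAB : c partA * c partB = -c partW ^ 2 := by
    rw [← map_mul, partA_mul_partB, map_neg, map_pow]
  have hEc : c euler = c partA - c partW + c partB := by rw [euler_eq, map_add, map_sub]
  have h2 := prod_conjugates_eq (c partA) (c partW) (c partB) (C ω) hz hAB
  rw [← hEc] at h2
  simp only [pow_one] at key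
  rw [h2] at key
  apply PowerSeries.map_injective (Int.castRingHom ℂ) Int.cast_injective
  rw [← hc, map_pow, ← key]
  simp only [map_mul, map_pow, map_add, map_ofNat]

/-! ### The action of Atkin's operator -/

/-- The generating series of the partition function, as the inverse of Euler's product. -/
noncomputable def partitionSeries : ℤ⟦X⟧ := PowerSeries.invOfUnit euler 1

theorem euler_mul_partitionSeries : euler * partitionSeries = 1 := by
  refine PowerSeries.mul_invOfUnit euler 1 ?_
  have h := coeff_pentagonalSeries_pentagonal ℤ 0
  rw [← coeff_zero_eq_constantCoeff_apply]
  simpa [pentagonal_def] using h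

/-- The quotient `X E(X ^ 25) / E(X)` for Euler's product `E`. -/
noncomputable def etaQuot : ℤ⟦X⟧ := partW * partitionSeries

/-- The Hauptmodul `X E(X ^ 5) ^ 6 / E(X) ^ 6` for Euler's product `E`. -/
noncomputable def hauptmodul : ℤ⟦X⟧ := X * dilate euler ^ 6 * partitionSeries ^ 6

theorem euler_mul_etaQuot : euler * etaQuot = partW := by
  rw [etaQuot]
  linear_combination partW * euler_mul_partitionSeries

theorem dilate_euler_mul : dilate euler * dilate partitionSeries = 1 := by
  rw [← map_mul, euler_mul_partitionSeries, map_one]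

theorem dilate_dilate_euler_mul :
    dilate (dilate euler) * dilate (dilate partitionSeries) = 1 := by
  rw [← map_mul, dilate_euler_mul, map_one]

theorem dilate_hauptmodul : dilate hauptmodul =
    X ^ 5 * dilate (dilate euler) ^ 6 * dilate partitionSeries ^ 6 := by
  rw [hauptmodul]
  simp only [map_mul, map_pow, dilate_X]

theorem dilate_hauptmodul_mul : dilate hauptmodul * hauptmodul = etaQuot ^ 6 := by
  rw [dilate_hauptmodul, hauptmodul, etaQuot, partW]
  have h : dilate euler ^ 6 * dilate partitionSeries ^ 6 = 1 := by
    rw [← mul_pow, dilate_euler_mul, one_pow]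
  linear_combination X ^ 6 * dilate (dilate euler) ^ 6 * partitionSeries ^ 6 * h

theorem dilate_euler_pow_six_mul : dilate euler ^ 6 * partitionSeries ^ 5 =
    dilate (dilate euler) * (1 + 5 * etaQuot + 15 * etaQuot ^ 2 + 25 * etaQuot ^ 3 +
      25 * etaQuot ^ 4) := by
  have h := euler_mul_partitionSeries
  rw [dilate_euler_pow_six, ← euler_mul_etaQuot]
  linear_combination dilate (dilate euler) * (1 + 5 * etaQuot + 15 * etaQuot ^ 2 +
    25 * etaQuot ^ 3 + 25 * etaQuot ^ 4) * (1 + (euler * partitionSeries) +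
      (euler * partitionSeries) ^ 2 + (euler * partitionSeries) ^ 3 +
      (euler * partitionSeries) ^ 4) * h

/-- The quintic equation of `etaQuot` over the series in `X ^ 5`. -/
theorem etaQuot_pow_five : etaQuot ^ 5 = dilate hauptmodul *
    (1 + 5 * etaQuot + 15 * etaQuot ^ 2 + 25 * etaQuot ^ 3 + 25 * etaQuot ^ 4) := by
  have h : dilate euler ^ 6 * dilate partitionSeries ^ 6 = 1 := by
    rw [← mul_pow, dilate_euler_mul, one_pow]
  rw [dilate_hauptmodul]
  calc etaQuot ^ 5 = X ^ 5 * dilate (dilate euler) ^ 5 * dilate partitionSeries ^ 6 *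
        (dilate euler ^ 6 * partitionSeries ^ 5) := by
        rw [etaQuot, partW]
        linear_combination -(X ^ 5 * dilate (dilate euler) ^ 5 * partitionSeries ^ 5) * h
    _ = _ := by
        rw [dilate_euler_pow_six_mul]
        ring

/-- The series `X E(X ^ 5) ^ 5`, which is sent to `partW ^ 5` by `X ↦ X ^ 5`. -/
noncomputable def baseFactor : ℤ⟦X⟧ := X * dilate euler ^ 5

theorem dilate_baseFactor : dilate baseFactor = partW ^ 5 := by
  rw [baseFactor, partW]
  simp only [map_mul, map_pow, dilate_X, mul_pow]

theorem atkinU_monomial (i j k : ℕ) (h : ((j + 2 * k : ℕ) : ZMod 5) ≠ 0) :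
    atkinU (partA ^ i * partW ^ j * partB ^ k) = 0 :=
  atkinU_eq_zero (by simpa using h) (monomial_mem_residueClass partA_mem partW_mem partB_mem i j k)

/-- For `i + j = 5`, the image of `partW ^ i * euler ^ j` is `baseFactor` times the constant term of
the Laurent polynomial `(x⁻¹ - 1 - x) ^ j`, which is `1, -1, -1, 5, -5` for `j ≤ 4`. -/
theorem atkinU_partW_pow_five : atkinU (partW ^ 5) = baseFactor := by
  rw [← dilate_baseFactor, atkinU_dilate]

theorem atkinU_partW_pow_four_mul : atkinU (partW ^ 4 * euler) = -baseFactor := by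
  have h : partW ^ 4 * euler = partA ^ 1 * partW ^ 4 * partB ^ 0 - partW ^ 5 +
      partA ^ 0 * partW ^ 4 * partB ^ 1 := by
    rw [euler_eq]
    ring
  rw [h, map_add, map_sub, atkinU_monomial 1 4 0 (by decide), atkinU_monomial 0 4 1 (by decide),
    atkinU_partW_pow_five]
  ring

theorem atkinU_partW_pow_three_mul : atkinU (partW ^ 3 * euler ^ 2) = -baseFactor := by
  have h : partW ^ 3 * euler ^ 2 = partA ^ 2 * partW ^ 3 * partB ^ 0
      - (2 : ℤ) • (partA ^ 1 * partW ^ 4 * partB ^ 0) - partW ^ 5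
      - (2 : ℤ) • (partA ^ 0 * partW ^ 4 * partB ^ 1) + partA ^ 0 * partW ^ 3 * partB ^ 2 := by
    rw [euler_eq]
    simp only [zsmul_eq_mul]
    push_cast
    linear_combination 2 * partW ^ 3 * partA_mul_partB
  rw [h]
  simp only [map_add, map_sub, map_zsmul]
  rw [atkinU_monomial 2 3 0 (by decide), atkinU_monomial 1 4 0 (by decide),
    atkinU_monomial 0 4 1 (by decide), atkinU_monomial 0 3 2 (by decide), atkinU_partW_pow_five]
  simp

/-- The cube of Euler's product has no exponents congruent to `2` or `4` modulo `5`, and its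
coefficients at exponents congruent to `3` are multiples of `5`. -/
theorem euler_pow_three : euler ^ 3 = partA ^ 3 * partW ^ 0 * partB ^ 0
    - (3 : ℤ) • (partA ^ 2 * partW ^ 1 * partB ^ 0) + (5 : ℤ) • partW ^ 3
    - (3 : ℤ) • (partA ^ 0 * partW ^ 1 * partB ^ 2) + partA ^ 0 * partW ^ 0 * partB ^ 3 := by
  rw [euler_eq]
  simp only [zsmul_eq_mul]
  push_cast
  linear_combination (3 * partA + 3 * partB - 6 * partW) * partA_mul_partB

theorem atkinU_partW_sq_mul : atkinU (partW ^ 2 * euler ^ 3) = (5 : ℤ) • baseFactor := by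
  have h : partW ^ 2 * euler ^ 3 = partA ^ 3 * partW ^ 2 * partB ^ 0
      - (3 : ℤ) • (partA ^ 2 * partW ^ 3 * partB ^ 0) + (5 : ℤ) • partW ^ 5
      - (3 : ℤ) • (partA ^ 0 * partW ^ 3 * partB ^ 2) + partA ^ 0 * partW ^ 2 * partB ^ 3 := by
    rw [euler_pow_three]
    simp only [zsmul_eq_mul]
    ring
  rw [h]
  simp only [map_add, map_sub, map_zsmul]
  rw [atkinU_monomial 3 2 0 (by decide), atkinU_monomial 2 3 0 (by decide),
    atkinU_monomial 0 3 2 (by decide), atkinU_monomial 0 2 3 (by decide), atkinU_partW_pow_five]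
  simp

theorem atkinU_partW_mul : atkinU (partW * euler ^ 4) = (-5 : ℤ) • baseFactor := by
  have h : partW * euler ^ 4 = partA ^ 4 * partW ^ 1 * partB ^ 0
      - (4 : ℤ) • (partA ^ 3 * partW ^ 2 * partB ^ 0)
      + (2 : ℤ) • (partA ^ 2 * partW ^ 3 * partB ^ 0)
      + (8 : ℤ) • (partA ^ 1 * partW ^ 4 * partB ^ 0) + (-5 : ℤ) • partW ^ 5
      + (8 : ℤ) • (partA ^ 0 * partW ^ 4 * partB ^ 1)
      + (2 : ℤ) • (partA ^ 0 * partW ^ 3 * partB ^ 2)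
      - (4 : ℤ) • (partA ^ 0 * partW ^ 2 * partB ^ 3) + partA ^ 0 * partW ^ 1 * partB ^ 4 := by
    rw [show euler ^ 4 = euler ^ 3 * euler by ring, euler_pow_three, euler_eq]
    simp only [zsmul_eq_mul]
    push_cast
    linear_combination partW * (partA ^ 2 - 3 * partA * partW - 3 * partB * partW + partB ^ 2) *
      partA_mul_partB
  rw [h]
  simp only [map_add, map_sub, map_zsmul]
  rw [atkinU_monomial 4 1 0 (by decide), atkinU_monomial 3 2 0 (by decide),
    atkinU_monomial 2 3 0 (by decide), atkinU_monomial 1 4 0 (by decide),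
    atkinU_monomial 0 4 1 (by decide), atkinU_monomial 0 3 2 (by decide),
    atkinU_monomial 0 2 3 (by decide), atkinU_monomial 0 1 4 (by decide), atkinU_partW_pow_five]
  simp

/-! ### Five-adic estimates -/

/-- The span of the multiples `5 ^ e T ^ j` of powers of the Hauptmodul, where `e` is the least
valuation allowed to the coefficient of `T ^ j` in the image of `etaQuot ^ (i - 4)` under Atkin's
operator. The shift by `4` makes room for the first five powers, from which the others are found
by recursion. -/
noncomputable def powerSpan (i : ℕ) : Submodule ℤ ℤ⟦X⟧ :=
  Submodule.span ℤ {f | ∃ j, i ≤ 5 * j + 4 ∧ f = 5 ^ ((5 * j + 3 - i) / 2) * hauptmodul ^ j}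

theorem mem_powerSpan {i j e : ℕ} (h : i ≤ 5 * j + 4) (he : (5 * j + 3 - i) / 2 ≤ e) (c : ℤ) :
    c • (5 ^ e * hauptmodul ^ j) ∈ powerSpan i := by
  obtain ⟨d, rfl⟩ := Nat.exists_eq_add_of_le he
  have h1 : c • ((5 : ℤ⟦X⟧) ^ ((5 * j + 3 - i) / 2 + d) * hauptmodul ^ j) =
      (c * 5 ^ d) • (5 ^ ((5 * j + 3 - i) / 2) * hauptmodul ^ j) := by
    simp only [zsmul_eq_mul]
    push_cast
    ring
  rw [h1]
  exact Submodule.smul_mem _ _ (Submodule.subset_span ⟨j, h, rfl⟩)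

theorem hauptmodul_mul_mem_powerSpan {i k e : ℕ} (hk : k ≤ 4) (he : (k + 1) / 2 ≤ e) (c : ℤ)
    {f : ℤ⟦X⟧} (hf : f ∈ powerSpan (i + k)) :
    c • (5 ^ e * (hauptmodul * f)) ∈ powerSpan (i + 5) := by
  induction hf using Submodule.span_induction with
  | mem x hx =>
    obtain ⟨j, hj, rfl⟩ := hx
    have h1 : c • ((5 : ℤ⟦X⟧) ^ e * (hauptmodul * (5 ^ ((5 * j + 3 - (i + k)) / 2) *
        hauptmodul ^ j))) =
        c • (5 ^ (e + (5 * j + 3 - (i + k)) / 2) * hauptmodul ^ (j + 1)) := by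
      ring_nf
    rw [h1]
    exact mem_powerSpan (by omega) (by omega) c
  | zero => simp
  | add x y _ _ hx hy =>
    rw [mul_add, mul_add, smul_add]
    exact add_mem hx hy
  | smul a x _ hx =>
    rw [mul_smul_comm, mul_smul_comm, smul_comm]
    exact Submodule.smul_mem _ _ hx

theorem atkinU_mul_etaQuot_pow (f : ℤ⟦X⟧) (i : ℕ) :
    atkinU (f * etaQuot ^ (i + 5)) = hauptmodul * (atkinU (f * etaQuot ^ i) +
      (5 : ℤ) • atkinU (f * etaQuot ^ (i + 1)) + (15 : ℤ) • atkinU (f * etaQuot ^ (i + 2)) +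
      (25 : ℤ) • atkinU (f * etaQuot ^ (i + 3)) + (25 : ℤ) • atkinU (f * etaQuot ^ (i + 4))) := by
  simp only [← map_zsmul, ← map_add]
  rw [← atkinU_dilate_mul]
  congr 1
  rw [pow_add etaQuot i 5, etaQuot_pow_five]
  simp only [zsmul_eq_mul]
  push_cast
  ring

/-- As `partW * euler ^ 4` is `partW ^ 5 / etaQuot ^ 4` and `partW ^ 5` is a series in `X ^ 5`, this
estimates the images of `etaQuot ^ (i - 4)`, negative exponents included, without Laurent series. -/
theorem atkinU_partW_mul_etaQuot_pow (i : ℕ) :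
    ∃ f ∈ powerSpan i, atkinU (partW * euler ^ 4 * etaQuot ^ i) = baseFactor * f := by
  induction i using Nat.strong_induction_on with
  | _ i ih =>
    have h0 := euler_mul_etaQuot
    have base (i e : ℕ) (hi : i ≤ 4) (he : (3 - i) / 2 ≤ e) (c : ℤ) :
        c • (5 : ℤ⟦X⟧) ^ e ∈ powerSpan i := by
      simpa using mem_powerSpan (i := i) (j := 0) (e := e) (by omega) (by omega) c
    match i, ih with
    | 0, _ =>
      refine ⟨(-1 : ℤ) • 5 ^ 1, base 0 1 (by norm_num) (by norm_num) _, ?_⟩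
      rw [pow_zero, mul_one, atkinU_partW_mul]
      simp only [zsmul_eq_mul]
      push_cast
      ring
    | 1, _ =>
      refine ⟨(1 : ℤ) • 5 ^ 1, base 1 1 (by norm_num) (by norm_num) _, ?_⟩
      rw [show partW * euler ^ 4 * etaQuot ^ 1 = partW ^ 2 * euler ^ 3 by
        linear_combination partW * euler ^ 3 * h0, atkinU_partW_sq_mul]
      simp only [zsmul_eq_mul]
      push_cast
      ring
    | 2, _ =>
      refine ⟨(-1 : ℤ) • 5 ^ 0, base 2 0 (by norm_num) (by norm_num) _, ?_⟩
      rw [show partW * euler ^ 4 * etaQuot ^ 2 = partW ^ 3 * euler ^ 2 by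
        linear_combination partW * euler ^ 2 * (euler * etaQuot + partW) * h0,
        atkinU_partW_pow_three_mul]
      simp
    | 3, _ =>
      refine ⟨(-1 : ℤ) • 5 ^ 0, base 3 0 (by norm_num) (by norm_num) _, ?_⟩
      rw [show partW * euler ^ 4 * etaQuot ^ 3 = partW ^ 4 * euler by
        rw [← h0]
        ring, atkinU_partW_pow_four_mul]
      simp
    | 4, _ =>
      refine ⟨(1 : ℤ) • 5 ^ 0, base 4 0 (by norm_num) (by norm_num) _, ?_⟩
      rw [show partW * euler ^ 4 * etaQuot ^ 4 = partW ^ 5 by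
        rw [← h0]
        ring, atkinU_partW_pow_five]
      simp
    | i + 5, ih =>
      obtain ⟨f0, hf0, e0⟩ := ih i (by omega)
      obtain ⟨f1, hf1, e1⟩ := ih (i + 1) (by omega)
      obtain ⟨f2, hf2, e2⟩ := ih (i + 2) (by omega)
      obtain ⟨f3, hf3, e3⟩ := ih (i + 3) (by omega)
      obtain ⟨f4, hf4, e4⟩ := ih (i + 4) (by omega)
      refine ⟨_, add_mem (add_mem (add_mem (add_mem
        (hauptmodul_mul_mem_powerSpan (k := 0) (e := 0) (by norm_num) (by norm_num) 1 hf0)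
        (hauptmodul_mul_mem_powerSpan (e := 1) (by norm_num) (by norm_num) 1 hf1))
        (hauptmodul_mul_mem_powerSpan (e := 1) (by norm_num) (by norm_num) 3 hf2))
        (hauptmodul_mul_mem_powerSpan (e := 2) (by norm_num) (by norm_num) 1 hf3))
        (hauptmodul_mul_mem_powerSpan (e := 2) (by norm_num) (by norm_num) 1 hf4), ?_⟩
      rw [atkinU_mul_etaQuot_pow, e0, e1, e2, e3, e4]
      simp only [zsmul_eq_mul]
      push_cast
      ring

theorem baseFactor_ne_zero : baseFactor ≠ 0 := by
  refine mul_ne_zero X_ne_zero (pow_ne_zero _ fun h => ?_)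
  have := dilate_euler_mul
  rw [h, zero_mul] at this
  exact zero_ne_one this

theorem hauptmodul_ne_zero : hauptmodul ≠ 0 := by
  have h1 : dilate euler ≠ 0 := fun h => by
    have := dilate_euler_mul
    rw [h, zero_mul] at this
    exact zero_ne_one this
  have h2 : partitionSeries ≠ 0 := fun h => by
    have := euler_mul_partitionSeries
    rw [h, mul_zero] at this
    exact zero_ne_one this
  exact mul_ne_zero (mul_ne_zero X_ne_zero (pow_ne_zero _ h1)) (pow_ne_zero _ h2)

/-- The image of a power of `etaQuot` under Atkin's operator is a polynomial in the Hauptmodul,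
with Watson's bounds on the valuations of its coefficients. -/
theorem atkinU_etaQuot_pow_mem (i : ℕ) : atkinU (etaQuot ^ i) ∈ powerSpan (i + 4) := by
  obtain ⟨f, hf, h⟩ := atkinU_partW_mul_etaQuot_pow (i + 4)
  rw [show partW * euler ^ 4 * etaQuot ^ (i + 4) = dilate baseFactor * etaQuot ^ i by
    rw [dilate_baseFactor, ← euler_mul_etaQuot]
    ring, atkinU_dilate_mul] at h
  rwa [mul_left_cancel₀ baseFactor_ne_zero h]

/-- The polynomials in the Hauptmodul `T` without constant term in which the coefficient of `T ^ j`
is a multiple of `5 ^ (N + ⌊(5 j - 5) / 2⌋)`. -/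
noncomputable def watsonModule (N : ℕ) : Submodule ℤ ℤ⟦X⟧ :=
  Submodule.span ℤ {f | ∃ j, 1 ≤ j ∧ f = 5 ^ (N + (5 * j - 5) / 2) * hauptmodul ^ j}

theorem mem_watsonModule {N j e : ℕ} (h : 1 ≤ j) (he : N + (5 * j - 5) / 2 ≤ e) :
    5 ^ e * hauptmodul ^ j ∈ watsonModule N := by
  obtain ⟨d, rfl⟩ := Nat.exists_eq_add_of_le he
  have h1 : (5 : ℤ⟦X⟧) ^ (N + (5 * j - 5) / 2 + d) * hauptmodul ^ j =
      (5 ^ d : ℤ) • (5 ^ (N + (5 * j - 5) / 2) * hauptmodul ^ j) := by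
    simp only [zsmul_eq_mul]
    push_cast
    ring
  rw [h1]
  exact Submodule.smul_mem _ _ (Submodule.subset_span ⟨j, h, rfl⟩)

/-- The images of `etaQuot ^ (6 j + e)` are multiples of `T ^ j`, and the quotient together with the
factor of `T ^ j` in `watsonModule N` meets the bounds of `watsonModule (N + δ)`. -/
theorem exists_mem_watsonModule {N δ j e : ℕ} (hj : 1 ≤ j) (he : e + δ ≤ 2) (he' : δ ≤ 1)
    {f : ℤ⟦X⟧} (hf : f ∈ powerSpan (6 * j + e + 4)) :
    ∃ g ∈ watsonModule (N + δ), 5 ^ (N + (5 * j - 5) / 2) * f = hauptmodul ^ j * g := by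
  induction hf using Submodule.span_induction with
  | mem x hx =>
    obtain ⟨l, hl, rfl⟩ := hx
    obtain ⟨i, rfl⟩ : ∃ i, l = j + i := ⟨l - j, by omega⟩
    have hle : N + δ + (5 * i - 5) / 2 ≤
        N + (5 * j - 5) / 2 + (5 * (j + i) + 3 - (6 * j + e + 4)) / 2 := by
      rcases hj.eq_or_lt with rfl | hj'
      -- the bound is sharp here, as the factor of `T` has no valuation beyond `N`
      · interval_cases δ <;> omega
      · omega
    refine ⟨5 ^ (N + (5 * j - 5) / 2 + (5 * (j + i) + 3 - (6 * j + e + 4)) / 2) * hauptmodul ^ i,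
      mem_watsonModule (by omega) hle, ?_⟩
    ring
  | zero => exact ⟨0, zero_mem _, by simp⟩
  | add x y _ _ hx hy =>
    obtain ⟨gx, hgx, ex⟩ := hx
    obtain ⟨gy, hgy, ey⟩ := hy
    exact ⟨gx + gy, add_mem hgx hgy, by rw [mul_add, mul_add, ex, ey]⟩
  | smul a x _ hx =>
    obtain ⟨gx, hgx, ex⟩ := hx
    exact ⟨a • gx, Submodule.smul_mem _ _ hgx, by rw [mul_smul_comm, mul_smul_comm, ex]⟩

theorem atkinU_etaQuot_pow_mul_mem {N δ e : ℕ} (he : e + δ ≤ 2) (he' : δ ≤ 1) {f : ℤ⟦X⟧}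
    (hf : f ∈ watsonModule N) : atkinU (etaQuot ^ e * f) ∈ watsonModule (N + δ) := by
  induction hf using Submodule.span_induction with
  | mem x hx =>
    obtain ⟨j, hj, rfl⟩ := hx
    obtain ⟨g, hg, h⟩ := exists_mem_watsonModule (N := N) hj he he'
      (atkinU_etaQuot_pow_mem (6 * j + e))
    have h1 : hauptmodul ^ j *
        atkinU (etaQuot ^ e * (5 ^ (N + (5 * j - 5) / 2) * hauptmodul ^ j)) =
        hauptmodul ^ j * g := by
      rw [← h, ← atkinU_dilate_mul, map_pow, show dilate hauptmodul ^ j * (etaQuot ^ e *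
        (5 ^ (N + (5 * j - 5) / 2) * hauptmodul ^ j)) = ((5 ^ (N + (5 * j - 5) / 2) : ℤ) : ℤ⟦X⟧) *
          etaQuot ^ (6 * j + e) by
        rw [pow_add etaQuot, pow_mul etaQuot, ← dilate_hauptmodul_mul, mul_pow]
        push_cast
        ring, atkinU_intCast_mul]
      push_cast
      rfl
    rwa [mul_left_cancel₀ (pow_ne_zero _ hauptmodul_ne_zero) h1]
  | zero => simp
  | add x y _ _ hx hy =>
    rw [mul_add, map_add]
    exact add_mem hx hy
  | smul a x _ hx =>
    rw [mul_smul_comm, map_zsmul]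
    exact Submodule.smul_mem _ _ hx

theorem atkinU_mem_watsonModule {N : ℕ} {f : ℤ⟦X⟧} (hf : f ∈ watsonModule N) :
    atkinU f ∈ watsonModule (N + 1) := by
  simpa using atkinU_etaQuot_pow_mul_mem (e := 0) (δ := 1) (by norm_num) (by norm_num) hf

theorem atkinU_etaQuot_mul_mem_watsonModule {N : ℕ} {f : ℤ⟦X⟧} (hf : f ∈ watsonModule N) :
    atkinU (etaQuot * f) ∈ watsonModule (N + 1) := by
  simpa using atkinU_etaQuot_pow_mul_mem (e := 1) (δ := 1) (by norm_num) (by norm_num) hf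

theorem atkinU_etaQuot_sq_mul_mem_watsonModule {N : ℕ} {f : ℤ⟦X⟧} (hf : f ∈ watsonModule N) :
    atkinU (etaQuot ^ 2 * f) ∈ watsonModule N :=
  atkinU_etaQuot_pow_mul_mem (e := 2) (δ := 0) (by norm_num) (by norm_num) hf

/-- The first step of the induction, which contains Ramanujan's congruence for `p(5 n + 4)`. -/
theorem atkinU_etaQuot_mem : atkinU etaQuot ∈ watsonModule 1 := by
  have h := atkinU_etaQuot_pow_mem 1
  rw [pow_one] at h
  refine Submodule.span_le.2 ?_ h
  rintro _ ⟨j, hj, rfl⟩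
  exact mem_watsonModule (by omega) (by omega)

theorem exists_eq_of_mem_watsonModule {N : ℕ} {f : ℤ⟦X⟧} (hf : f ∈ watsonModule N) :
    ∃ (c : ℤ) (g : ℤ⟦X⟧), f = 5 ^ N * (c * hauptmodul + 5 * g) := by
  induction hf using Submodule.span_induction with
  | mem x hx =>
    obtain ⟨j, hj, rfl⟩ := hx
    rcases hj.eq_or_lt with rfl | hj
    · exact ⟨1, 0, by simp⟩
    · obtain ⟨d, hd⟩ : ∃ d, (5 * j - 5) / 2 = d + 1 := ⟨(5 * j - 5) / 2 - 1, by omega⟩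
      refine ⟨0, 5 ^ d * hauptmodul ^ j, ?_⟩
      rw [hd]
      push_cast
      ring
  | zero => exact ⟨0, 0, by simp⟩
  | add x y _ _ hx hy =>
    obtain ⟨c, g, rfl⟩ := hx
    obtain ⟨c', g', rfl⟩ := hy
    exact ⟨c + c', g + g', by push_cast; ring⟩
  | smul a x _ hx =>
    obtain ⟨c, g, rfl⟩ := hx
    refine ⟨a * c, a * g, ?_⟩
    rw [zsmul_eq_mul]
    push_cast
    ring

/-! ### Generating series and arithmetic progressions -/

theorem restrictedSeries_mul (ℓ : ℕ) (hℓ : ℓ ≠ 0) :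
    (PowerSeries.mk fun n => ((Nat.Partition.restricted n (ℓ ∣ ·)).card : ℤ)) *
      PowerSeries.expand ℓ hℓ euler = 1 := by
  open scoped PowerSeries.WithPiTopology in
  have h := (Nat.Partition.hasProd_powerSeriesMk_card_restricted ℤ (ℓ ∣ ·)).mul
    (hasProd_expand_pentagonalSeries (R := ℤ) ℓ hℓ)
  refine h.unique (hasProd_one.congr_fun fun i => ?_)
  split_ifs
  · simp_rw [pow_mul]
    exact WithPiTopology.tsum_pow_mul_one_sub_of_constantCoeff_eq_zero (by simp)
  · exact one_mul 1

theorem dilate_iterate_eq_expand (m : ℕ) (f : ℤ⟦X⟧) :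
    dilate^[m] f = PowerSeries.expand (5 ^ m) (pow_ne_zero m (by norm_num)) f := by
  induction m with
  | zero => simp
  | succ m ih =>
    rw [Function.iterate_succ_apply', ih, dilate, ← expand_mul]
    congr 1
    simp only [pow_succ']

theorem dilate_iterate_mul (m : ℕ) (f g : ℤ⟦X⟧) :
    dilate^[m] (f * g) = dilate^[m] f * dilate^[m] g := by
  simp only [dilate_iterate_eq_expand, map_mul]

theorem partition_card_eq (n : ℕ) :
    Fintype.card (Nat.Partition n) = (Nat.Partition.restricted n (1 ∣ ·)).card := by
  simp [Nat.Partition.restricted]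

theorem twoColorCount_eq (ℓ n : ℕ) : twoColorCount ℓ n =
    ∑ ab ∈ Finset.HasAntidiagonal.antidiagonal n, (Nat.Partition.restricted ab.1 (1 ∣ ·)).card *
      (Nat.Partition.restricted ab.2 (ℓ ∣ ·)).card := by
  rw [twoColorCount, ← Finset.sum_coe_sort (Finset.HasAntidiagonal.antidiagonal n)]
  refine Fintype.card_sigma.trans (Finset.sum_congr rfl fun ab _ => ?_)
  rw [Fintype.card_prod, partition_card_eq, Fintype.card_subtype]
  rfl

/-- The generating series of the partitions in two colors, one of which is restricted to multiples
of `5 ^ m`. -/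
theorem mk_twoColorCount (m : ℕ) : (PowerSeries.mk fun n => (twoColorCount (5 ^ m) n : ℤ)) =
    partitionSeries * dilate^[m] partitionSeries := by
  have h1 := restrictedSeries_mul 1 one_ne_zero
  rw [expand_one_apply] at h1
  have h2 := restrictedSeries_mul (5 ^ m) (pow_ne_zero m (by norm_num))
  rw [← dilate_iterate_eq_expand] at h2
  have h3 := euler_mul_partitionSeries
  have h4 : dilate^[m] euler * dilate^[m] partitionSeries = 1 := by
    rw [← dilate_iterate_mul, h3, dilate_iterate_eq_expand, map_one]
  have h5 := left_inv_eq_right_inv h1 h3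
  have h6 := left_inv_eq_right_inv h2 h4
  rw [← h6, ← h5]
  ext n
  rw [coeff_mk, coeff_mul, twoColorCount_eq]
  simp only [coeff_mk]
  push_cast
  rfl

/-- The series `M` carries a progression of step `5 ^ m` of coefficients of `F`: its coefficient at
`n + 1` is that of `F` at `5 ^ m (n + 1) - c`. The bound on `c` makes the subtraction exact, and the
constant coefficient of `M` is left free. -/
structure IsProgression (F : ℤ⟦X⟧) (m c : ℕ) (M : ℤ⟦X⟧) : Prop where
  lt : c < 5 ^ m
  coeff_succ : ∀ n, coeff (n + 1) M = coeff (5 ^ m * (n + 1) - c) F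

theorem IsProgression.zero (F : ℤ⟦X⟧) : IsProgression F 0 0 F where
  lt := by norm_num
  coeff_succ n := by simp

theorem IsProgression.atkinU {F M : ℤ⟦X⟧} {m c : ℕ} (h : IsProgression F m c M) {e : ℕ}
    (he : e ≤ 4) : IsProgression F (m + 1) (5 ^ m * e + c) (atkinU (X ^ e * M)) where
  lt := by
    have := h.lt
    have := Nat.mul_le_mul_left (5 ^ m) he
    rw [pow_succ]
    omega
  coeff_succ n := by
    obtain ⟨l, hl⟩ : ∃ l, 5 * (n + 1) = l + 1 + e := ⟨5 * n + 4 - e, by omega⟩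
    rw [coeff_atkinU, hl, add_comm (l + 1) e, coeff_X_pow_mul', if_pos (by omega),
      Nat.add_sub_cancel_left, h.coeff_succ]
    congr 2
    have h1 : 5 ^ (m + 1) * (n + 1) = 5 ^ m * (l + 1) + 5 ^ m * e := by
      rw [pow_succ, mul_assoc, hl]
      ring
    omega

/-- If `M` is the progression of offset `5 ^ m - δ`, its coefficient at `n + 1` is that of `F` at
`5 ^ m n + δ`. -/
theorem IsProgression.coeff_eq {F M : ℤ⟦X⟧} {m c : ℕ} (h : IsProgression F m c M) (n δ : ℕ)
    (hδ : δ + c = 5 ^ m) : coeff (5 ^ m * n + δ) F = coeff (n + 1) M := by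
  rw [h.coeff_succ]
  congr 2
  rw [mul_add, mul_one]
  omega

theorem X_mul_partitionSeries : X * partitionSeries =
    etaQuot * dilate (dilate partitionSeries) := by
  rw [etaQuot, partW]
  linear_combination -(X * partitionSeries) * dilate_dilate_euler_mul

theorem atkinU_odd (L : ℤ⟦X⟧) (f : ℤ⟦X⟧) :
    atkinU (X ^ 0 * (L * dilate partitionSeries * dilate f)) =
      atkinU L * partitionSeries * f := by
  rw [show X ^ 0 * (L * dilate partitionSeries * dilate f) = dilate (partitionSeries * f) * L by
    rw [map_mul]; ring, atkinU_dilate_mul]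
  ring

theorem atkinU_even (L : ℤ⟦X⟧) (f : ℤ⟦X⟧) :
    atkinU (X ^ 1 * (L * partitionSeries * dilate f)) =
      atkinU (etaQuot * L) * dilate partitionSeries * f := by
  rw [show X ^ 1 * (L * partitionSeries * dilate f) =
      dilate (dilate partitionSeries * f) * (etaQuot * L) by
    rw [map_mul]
    linear_combination L * dilate f * X_mul_partitionSeries, atkinU_dilate_mul]
  ring

theorem atkinU_sq (L : ℤ⟦X⟧) :
    atkinU (X ^ 2 * (L * partitionSeries * partitionSeries)) =
      atkinU (etaQuot ^ 2 * L) * dilate partitionSeries * dilate partitionSeries := by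
  rw [show X ^ 2 * (L * partitionSeries * partitionSeries) =
      dilate (dilate partitionSeries * dilate partitionSeries) * (etaQuot ^ 2 * L) by
    rw [map_mul]
    linear_combination L * (X * partitionSeries + etaQuot * dilate (dilate partitionSeries)) *
      X_mul_partitionSeries, atkinU_dilate_mul]
  ring

/-- Watson's form of the Ramanujan congruences modulo odd powers of `5`. The second color
enters through a series in a power of `X` that each step turns into the previous iterate. -/
theorem exists_isProgression_odd (k d : ℕ) : ∃ L ∈ watsonModule (2 * k + 1), ∃ c : ℕ,
    24 * c + 1 = 5 ^ (2 * k + 2) ∧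
    IsProgression (partitionSeries * dilate^[2 * k + 1 + d] partitionSeries) (2 * k + 1) c
      (L * dilate partitionSeries * dilate^[d] partitionSeries) := by
  induction k generalizing d with
  | zero =>
    have h := (IsProgression.zero (partitionSeries * dilate^[d + 1] partitionSeries)).atkinU
      (e := 1) (by norm_num)
    have h2 := atkinU_even 1 (dilate^[d] partitionSeries)
    rw [mul_one, one_mul, ← Function.iterate_succ_apply' dilate d partitionSeries] at h2
    rw [h2] at h
    refine ⟨_, atkinU_etaQuot_mem, 5 ^ 0 * 1 + 0, by norm_num, ?_⟩
    rw [show 2 * 0 + 1 + d = d + 1 by omega]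
    exact h
  | succ k ih =>
    obtain ⟨L, hL, c, hc, h⟩ := ih (d + 2)
    have h1 := h.atkinU (e := 0) (by norm_num)
    rw [Function.iterate_succ_apply' dilate (d + 1), atkinU_odd] at h1
    have h2 := h1.atkinU (e := 1) (by norm_num)
    rw [Function.iterate_succ_apply' dilate d, atkinU_even] at h2
    refine ⟨_, atkinU_etaQuot_mul_mem_watsonModule (atkinU_mem_watsonModule hL),
      5 ^ (2 * k + 1 + 1) * 1 + (5 ^ (2 * k + 1) * 0 + c), ?_, ?_⟩
    · rw [show 2 * (k + 1) + 2 = 2 * k + 1 + 1 + 1 + 1 by ring, pow_succ _ (2 * k + 1 + 1 + 1),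
        pow_succ _ (2 * k + 1 + 1)]
      rw [show 2 * k + 2 = 2 * k + 1 + 1 by ring] at hc
      omega
    · rw [show 2 * (k + 1) + 1 + d = 2 * k + 1 + (d + 2) by ring]
      exact h2

/-- Each further step of the progression for `ℓ = 5 ^ (2 k + 1)` gains a factor `5`. -/
theorem exists_isProgression_of_odd (k β : ℕ) : ∃ L ∈ watsonModule (2 * k + 1 + β), ∃ c : ℕ,
    24 * c + 5 ^ (2 * k + 1) + 1 = 6 * 5 ^ (2 * k + 1 + β) ∧
    IsProgression (partitionSeries * dilate^[2 * k + 1] partitionSeries) (2 * k + 1 + β) c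
      (L * dilate partitionSeries * partitionSeries) := by
  induction β with
  | zero =>
    obtain ⟨L, hL, c, hc, h⟩ := exists_isProgression_odd k 0
    refine ⟨L, hL, c, ?_, h⟩
    rw [add_zero]
    rw [show 2 * k + 2 = 2 * k + 1 + 1 by ring, pow_succ] at hc
    omega
  | succ β ih =>
    obtain ⟨L, hL, c, hc, h⟩ := ih
    have h1 := h.atkinU (e := 1) (by norm_num)
    rw [show L * dilate partitionSeries * partitionSeries =
      L * partitionSeries * dilate partitionSeries by ring, atkinU_even] at h1
    refine ⟨_, atkinU_etaQuot_mul_mem_watsonModule hL, _, ?_, h1⟩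
    rw [← add_assoc, pow_succ _ (2 * k + 1 + β)]
    omega

/-- Two further steps of the progression for `ℓ = 5 ^ (2 k + 2)` gain a factor `5`. -/
theorem exists_isProgression_of_even (k β : ℕ) : ∃ L ∈ watsonModule (2 * k + 1 + β), ∃ c : ℕ,
    24 * c + 5 ^ (2 * k + 2) + 1 = 10 * 5 ^ (2 * k + 1 + 2 * β) ∧
    IsProgression (partitionSeries * dilate^[2 * k + 2] partitionSeries) (2 * k + 1 + 2 * β) c
      (L * dilate partitionSeries * dilate partitionSeries) := by
  induction β with
  | zero =>
    obtain ⟨L, hL, c, hc, h⟩ := exists_isProgression_odd k 1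
    refine ⟨L, hL, c, ?_, h⟩
    rw [mul_zero, add_zero]
    rw [show 2 * k + 2 = 2 * k + 1 + 1 by ring, pow_succ] at *
    omega
  | succ β ih =>
    obtain ⟨L, hL, c, hc, h⟩ := ih
    have h1 := h.atkinU (e := 0) (by norm_num)
    rw [atkinU_odd] at h1
    have h2 := h1.atkinU (e := 2) (by norm_num)
    rw [atkinU_sq] at h2
    refine ⟨_, atkinU_etaQuot_sq_mul_mem_watsonModule (atkinU_mem_watsonModule hL), _, ?_, h2⟩
    rw [show 2 * k + 1 + 2 * (β + 1) = 2 * k + 1 + 2 * β + 1 + 1 by ring,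
      pow_succ _ (2 * k + 1 + 2 * β + 1), pow_succ _ (2 * k + 1 + 2 * β)]
    omega

theorem exists_isProgression_of_even_succ (k β : ℕ) :
    ∃ L ∈ watsonModule (2 * k + 2 + β), ∃ c : ℕ,
    24 * c + 5 ^ (2 * k + 2) + 1 = 2 * 5 ^ (2 * k + 2 + 2 * β) ∧
    IsProgression (partitionSeries * dilate^[2 * k + 2] partitionSeries) (2 * k + 2 + 2 * β) c
      (L * partitionSeries * partitionSeries) := by
  obtain ⟨L, hL, c, hc, h⟩ := exists_isProgression_of_even k β
  have h1 := h.atkinU (e := 0) (by norm_num)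
  rw [atkinU_odd] at h1
  rw [show 2 * k + 2 + 2 * β = 2 * k + 1 + 2 * β + 1 by ring,
    show 2 * k + 2 + β = 2 * k + 1 + β + 1 by ring]
  refine ⟨_, atkinU_mem_watsonModule hL, _, ?_, h1⟩
  rw [pow_succ _ (2 * k + 1 + 2 * β)]
  omega

theorem pow_dvd_coeff {N : ℕ} {L : ℤ⟦X⟧} (hL : L ∈ watsonModule N) (f : ℤ⟦X⟧) (n : ℕ) :
    (5 : ℤ) ^ N ∣ coeff n (L * f) := by
  obtain ⟨c, g, rfl⟩ := exists_eq_of_mem_watsonModule hL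
  rw [show (5 : ℤ⟦X⟧) ^ N * (c * hauptmodul + 5 * g) * f =
    C ((5 : ℤ) ^ N) * ((c * hauptmodul + 5 * g) * f) by
    rw [map_pow, map_ofNat]; ring, coeff_C_mul]
  exact dvd_mul_right _ _

theorem intCast_dvd_coeff (a : ℤ) (f : ℤ⟦X⟧) (n : ℕ) : a ∣ coeff n ((a : ℤ⟦X⟧) * f) := by
  rw [show (a : ℤ⟦X⟧) = C a from (eq_intCast C a).symm, coeff_C_mul]
  exact dvd_mul_right _ _

theorem five_dvd_coeff_euler_pow_three_mul (f : ℤ⟦X⟧) (n r : ℕ) (hr : r = 2 ∨ r = 3 ∨ r = 4) :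
    (5 : ℤ) ∣ coeff (5 * n + r) (dilate f * euler ^ 3) := by
  have hmem (i j k : ℕ) :=
    SetLike.mul_mem_graded (dilate_mem_residueClass f)
      (monomial_mem_residueClass partA_mem partW_mem partB_mem i j k)
  have hc : ((5 * n + r : ℕ) : ZMod 5) = r := by
    rw [Nat.cast_add, Nat.cast_mul, show ((5 : ℕ) : ZMod 5) = 0 from rfl, zero_mul, zero_add]
  have h0 : ∀ i j k : ℕ, ((r : ℕ) : ZMod 5) ≠ ((j + 2 * k : ℕ) : ZMod 5) →
      coeff (5 * n + r) (dilate f * (partA ^ i * partW ^ j * partB ^ k)) = 0 := by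
    intro i j k h
    refine hmem i j k _ ?_
    rw [hc, zero_add]
    simpa using h
  rw [euler_pow_three]
  simp only [mul_add, mul_sub, mul_smul_comm, map_add, map_sub, map_zsmul]
  rw [h0 3 0 0 (by rcases hr with rfl | rfl | rfl <;> decide),
    h0 2 1 0 (by rcases hr with rfl | rfl | rfl <;> decide),
    h0 0 1 2 (by rcases hr with rfl | rfl | rfl <;> decide),
    h0 0 0 3 (by rcases hr with rfl | rfl | rfl <;> decide)]
  simp

/-- Modulo `5` the Hauptmodul term of a progression is `X E ^ 3` times a series in `X ^ 5`. -/
theorem exists_hauptmodul_mul_eq : ∃ f g : ℤ⟦X⟧,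
    hauptmodul * dilate partitionSeries * partitionSeries =
      X * (dilate f * euler ^ 3 + 5 * g) := by
  set D := dilate (dilate euler)
  set Q := dilate partitionSeries
  set H := etaQuot + 3 * etaQuot ^ 2 + 5 * etaQuot ^ 3 + 5 * etaQuot ^ 4 with hH
  have h5 : dilate euler ^ 6 * partitionSeries ^ 5 = D * (1 + 5 * H) := by
    rw [dilate_euler_pow_six_mul, hH]
    ring
  have hQ : dilate euler * Q = 1 := dilate_euler_mul
  have hQ6 : dilate euler ^ 6 * Q ^ 6 = 1 := by rw [← mul_pow, hQ, one_pow]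
  have hP : euler * partitionSeries = 1 := euler_mul_partitionSeries
  have h5' : partitionSeries ^ 5 = D * Q ^ 6 * (1 + 5 * H) := by
    linear_combination Q ^ 6 * h5 - partitionSeries ^ 5 * hQ6
  have hP3 : euler ^ 3 * partitionSeries ^ 3 = 1 := by rw [← mul_pow, hP, one_pow]
  refine ⟨euler ^ 5 * (dilate euler * partitionSeries ^ 6) ^ 2,
    dilate euler ^ 5 * euler ^ 3 * (D * Q ^ 6) ^ 2 * (2 * H + 5 * H ^ 2), ?_⟩
  have h10 : partitionSeries ^ 7 = euler ^ 3 * (partitionSeries ^ 5) ^ 2 := by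
    linear_combination -(partitionSeries ^ 7) * hP3
  simp only [map_mul, map_pow]
  calc hauptmodul * Q * partitionSeries = X * (dilate euler ^ 5 * partitionSeries ^ 7) := by
        rw [hauptmodul]
        linear_combination X * dilate euler ^ 5 * partitionSeries ^ 7 * hQ
    _ = _ := by
        rw [h10, h5']
        ring

theorem pow_succ_dvd_coeff {N : ℕ} {L : ℤ⟦X⟧} (hL : L ∈ watsonModule N) (n r : ℕ)
    (hr : r = 2 ∨ r = 3 ∨ r = 4) :
    (5 : ℤ) ^ (N + 1) ∣
      coeff (5 * n + r + 1) (L * dilate partitionSeries * partitionSeries) := by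
  obtain ⟨c, g, rfl⟩ := exists_eq_of_mem_watsonModule hL
  obtain ⟨f, g', h⟩ := exists_hauptmodul_mul_eq
  have h1 : (5 : ℤ⟦X⟧) ^ N * ((c : ℤ⟦X⟧) * hauptmodul + 5 * g) * dilate partitionSeries *
      partitionSeries = ((5 ^ N * c : ℤ) : ℤ⟦X⟧) * (X * (dilate f * euler ^ 3)) +
      ((5 ^ (N + 1) : ℤ) : ℤ⟦X⟧) *
        ((c : ℤ⟦X⟧) * (X * g') + g * dilate partitionSeries * partitionSeries) := by
    push_cast
    linear_combination (5 : ℤ⟦X⟧) ^ N * (c : ℤ⟦X⟧) * h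
  rw [h1, map_add]
  refine dvd_add ?_ (intCast_dvd_coeff _ _ _)
  rw [← eq_intCast C, coeff_C_mul, coeff_succ_X_mul, pow_succ]
  exact mul_dvd_mul (dvd_mul_right _ _) (five_dvd_coeff_euler_pow_three_mul f n r hr)

theorem twoColorCount_modEq {m N a : ℕ}
    (h : (5 : ℤ) ^ N ∣ coeff a (partitionSeries * dilate^[m] partitionSeries)) :
    twoColorCount (5 ^ m) a ≡ 0 [MOD 5 ^ N] := by
  rw [← mk_twoColorCount, coeff_mk] at h
  rw [Nat.modEq_zero_iff_dvd]
  exact_mod_cast h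

theorem twoColorCount_of_even_succ (n β k : ℕ) :
    24 ∣ 22 * 5 ^ (2 * k + 2 + 2 * β) + 5 ^ (2 * k + 2) + 1 ∧
      twoColorCount (5 ^ (2 * k + 2)) (5 ^ (2 * k + 2 + 2 * β) * n +
        (22 * 5 ^ (2 * k + 2 + 2 * β) + 5 ^ (2 * k + 2) + 1) / 24) ≡ 0
          [MOD 5 ^ (2 * k + 2 + β)] := by
  obtain ⟨L, hL, c, hc, h⟩ := exists_isProgression_of_even_succ k β
  refine ⟨by omega, twoColorCount_modEq ?_⟩
  have := h.lt
  rw [h.coeff_eq n _ (by omega), mul_assoc]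
  exact pow_dvd_coeff hL _ _

end FiveAdicPartition

open FiveAdicPartition in
theorem theorem1p1 (n β k : ℕ) (hk : 1 ≤ k) :
    (24 ∣ 18 * 5 ^ (2 * k + β - 1) + 5 ^ (2 * k - 1) + 1 ∧
      twoColorCount (5 ^ (2 * k - 1))
        (5 ^ (2 * k + β - 1) * n + (18 * 5 ^ (2 * k + β - 1) + 5 ^ (2 * k - 1) + 1) / 24)
          ≡ 0 [MOD 5 ^ (2 * k + β - 1)]) ∧
    (24 ∣ 14 * 5 ^ (2 * k + 2 * β - 1) + 5 ^ (2 * k) + 1 ∧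
      twoColorCount (5 ^ (2 * k))
        (5 ^ (2 * k + 2 * β - 1) * n + (14 * 5 ^ (2 * k + 2 * β - 1) + 5 ^ (2 * k) + 1) / 24)
          ≡ 0 [MOD 5 ^ (2 * k + β - 1)]) ∧
    (24 ∣ 22 * 5 ^ (2 * k + 2 * β) + 5 ^ (2 * k) + 1 ∧
      twoColorCount (5 ^ (2 * k))
        (5 ^ (2 * k + 2 * β) * n + (22 * 5 ^ (2 * k + 2 * β) + 5 ^ (2 * k) + 1) / 24)
          ≡ 0 [MOD 5 ^ (2 * k + β)]) ∧
    (∀ r : ℕ, r ∈ ({2, 3, 4} : Set ℕ) →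
      24 ∣ (24 * r + 18) * 5 ^ (2 * k + β - 1) + 5 ^ (2 * k - 1) + 1 ∧
      twoColorCount (5 ^ (2 * k - 1))
        (5 ^ (2 * k + β) * n +
            ((24 * r + 18) * 5 ^ (2 * k + β - 1) + 5 ^ (2 * k - 1) + 1) / 24)
          ≡ 0 [MOD 5 ^ (2 * k + β)]) ∧
    (24 ∣ 22 * 5 ^ (2 * k + 2 * β + 2) + 5 ^ (2 * k) + 1 ∧
      twoColorCount (5 ^ (2 * k))
        (5 ^ (2 * k + 2 * β + 2) * n +
            (22 * 5 ^ (2 * k + 2 * β + 2) + 5 ^ (2 * k) + 1) / 24)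
          ≡ 0 [MOD 5 ^ (2 * k + β + 1)]) := by
  obtain ⟨k, rfl⟩ : ∃ l, k = l + 1 := ⟨k - 1, by omega⟩
  rw [show 2 * (k + 1) + β - 1 = 2 * k + 1 + β by omega,
    show 2 * (k + 1) - 1 = 2 * k + 1 by omega,
    show 2 * (k + 1) + 2 * β - 1 = 2 * k + 1 + 2 * β by omega,
    show 2 * (k + 1) = 2 * k + 2 by omega]
  refine ⟨?_, ?_, twoColorCount_of_even_succ n β k, ?_, ?_⟩
  · obtain ⟨L, hL, c, hc, h⟩ := exists_isProgression_of_odd k β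
    refine ⟨by omega, twoColorCount_modEq ?_⟩
    have := h.lt
    rw [h.coeff_eq n _ (by omega), mul_assoc]
    exact pow_dvd_coeff hL _ _
  · obtain ⟨L, hL, c, hc, h⟩ := exists_isProgression_of_even k β
    refine ⟨by omega, twoColorCount_modEq ?_⟩
    have := h.lt
    rw [h.coeff_eq n _ (by omega), mul_assoc]
    exact pow_dvd_coeff hL _ _
  · intro r hr
    obtain ⟨L, hL, c, hc, h⟩ := exists_isProgression_of_odd k β
    have hlt := h.lt
    have hδ : (24 * r + 18) * 5 ^ (2 * k + 1 + β) + 5 ^ (2 * k + 1) + 1 =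
        24 * (5 ^ (2 * k + 1 + β) * r + (5 ^ (2 * k + 1 + β) - c)) := by
      rw [add_mul, mul_assoc, mul_comm r]
      omega
    -- the coefficient at `n` in the class `r` is the one at `5 n + r` of the first progression
    rw [hδ, Nat.mul_div_cancel_left _ (by norm_num)]
    refine ⟨dvd_mul_right _ _, ?_⟩
    rw [show 2 * k + 2 + β = 2 * k + 1 + β + 1 by ring]
    refine twoColorCount_modEq ?_
    rw [show 5 ^ (2 * k + 1 + β + 1) * n + (5 ^ (2 * k + 1 + β) * r + (5 ^ (2 * k + 1 + β) - c)) =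
        5 ^ (2 * k + 1 + β) * (5 * n + r) + (5 ^ (2 * k + 1 + β) - c) by ring,
      h.coeff_eq (5 * n + r) _ (by omega)]
    exact pow_succ_dvd_coeff hL n r (by simpa using hr)
  -- this progression is the third one with `β + 1` for `β`
  · exact twoColorCount_of_even_succ n (β + 1) k
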